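/- Let $A\in\mathbb R^{m\times n}$ be a nonzero matrix of rank $k$ with condition number $\kappa=\sigma_{\max}/\sigma_{\min}$, where $\sigma_{\max}$ and $\sigma_{\min}$ are the largest and the smallest nonzero singular values of $A$, and let $\varepsilon>0$ and $\delta\in(0,1)$. Write $A_{(i)}$ and $A^{(j)}$ for the rows and columns of $A$; to sample from a nonzero vector $v$ means to draw the index $i$ with probability $v_i^2/\|v\|^2$. The randomized algorithm $\mathrm{FKV}(A,k,\varepsilon,\delta)$ works as follows, with $$p=\Big\lceil 10^7\max\Big\{\frac{k^4}{\varepsilon^3},\frac{k^2}{\varepsilon^4}\Big\}\Big(1+\log\frac1\delta\Big)\Big\rceil+1 .$$ 1. Draw row indices $i_1,\dots,i_p$ independently from the distribution $P(i)=\|A_{(i)}\|^2/\|A\|_F^2$, and let $S\in\mathbb R^{p\times n}$ have the rows $A_{(i_t)}/\sqrt{p\,P(i_t)}$. 2. Given these rows, draw column indices $j_1,\dots,j_p$ independently, each by choosing $t\in\{1,\dots,p\}$ uniformly at random and then sampling from the vector $A_{(i_t)}$. With $P'$ the resulting distribution of a column index, let $W\in\mathbb R^{p\times p}$ have the columns $S^{(j_s)}/\sqrt{p\,P'(j_s)}$.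 3. Compute the singular values $\sigma_1\ge\sigma_2\ge\dots\ge\sigma_p\ge0$ of $W$ and corresponding orthonormal left singular vectors $u_1,\dots,u_p$ (by any routine that does so). Let $l\le k$ be the number of indices $t\le k$ with $\sigma_t^2\ge\frac{\varepsilon}{8k}\|W\|_F^2$; these are the first $l$ indices. 4. Return $i_1,\dots,i_p$, $u_1,\dots,u_l$ and $\sigma_1,\dots,\sigma_l$. This is a description of the matrix $\hat V\in\mathbb R^{n\times l}$ with columns $\hat V^{(t)}=S^{T}u_t/\sigma_t$. **Statement.** If $\varepsilon<\dfrac1{k\kappa^2}$, then with probability at least $1-\delta$ the output $\hat V$ of $\mathrm{FKV}(A,k,\varepsilon,\delta)$ satisfies $$\operatorname{span}\{\hat V^{(i)} : 1\le i\le l\}=\operatorname{span}\{A_{(i)} : 1\le i\le m\},\qquad l\le k.$$ -/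

import Mathlib

noncomputable section

/-! ### Length-squared sampling -/

/-- The `ℓ²`-norm sampling distribution of a vector `v`: index `i` is drawn with probability
`v i ^ 2 / ‖v‖ ^ 2`.  (For `v = 0`, which is never sampled by the algorithm below, the uniform
distribution is used as a dummy value.) -/
def l2Sample {N : ℕ} [NeZero N] (v : Fin N → ℝ) : PMF (Fin N) :=
  if h : ∑ i, v i ^ 2 = 0 then PMF.uniformOfFintype (Fin N)
  else PMF.ofFintype (fun i => ENNReal.ofReal (v i ^ 2 / ∑ j, v j ^ 2)) (by
    rw [← ENNReal.ofReal_sum_of_nonneg (fun i _ => by positivity), ← Finset.sum_div, div_self h,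
      ENNReal.ofReal_one])

/-- The law of `p` independent samples from `P`. -/
def iidSample {α : Type*} [Fintype α] (p : ℕ) (P : PMF α) : PMF (Fin p → α) :=
  PMF.ofFintype (fun x => ∏ t, P (x t)) (by
    classical
    rw [← Fintype.prod_sum (fun (_ : Fin p) (a : α) => P a)]
    have h : ∑ a, P a = 1 := by rw [← tsum_fintype (L := .unconditional α)]; exact P.tsum_coe
    simp [h])

/-- The squared Frobenius norm. -/
def frobSq {m n : ℕ} (A : Matrix (Fin m) (Fin n) ℝ) : ℝ := ∑ i, ∑ j, A i j ^ 2

/-! ### Condition number -/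

/-- The ratio of the largest and the smallest nonzero singular value of a matrix.  Mathlib lists
the singular values in decreasing order, starting at index `0`; exactly the first `rank A` of
them are nonzero. -/
def condNumber {m n : ℕ} (A : Matrix (Fin m) (Fin n) ℝ) : ℝ :=
  (Matrix.toEuclideanLin A).singularValues 0 /
    (Matrix.toEuclideanLin A).singularValues (A.rank - 1)

/-! ### Left singular vectors of a small square matrix -/

/-- A list of the singular values `σ 0 ≥ σ 1 ≥ … ≥ 0` of a square matrix `W`, together with an
orthonormal system of corresponding left singular vectors `u t`. -/
structure LeftSVD {N : ℕ} (W : Matrix (Fin N) (Fin N) ℝ) where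
  u : Fin N → EuclideanSpace ℝ (Fin N)
  σ : Fin N → ℝ
  orthonormal : Orthonormal ℝ u
  nonneg : ∀ t, 0 ≤ σ t
  antitone : Antitone σ
  eigen : ∀ t, (W * W.transpose).mulVec (u t).ofLp = σ t ^ 2 • (u t).ofLp

/-- Every square matrix has left singular vectors. -/
instance LeftSVD.instNonempty {N : ℕ} (W : Matrix (Fin N) (Fin N) ℝ) : Nonempty (LeftSVD W) := by
  have hpos : (W * W.transpose).PosSemidef := by
    simpa using Matrix.posSemidef_self_mul_conjTranspose W
  have hp : (Matrix.toEuclideanLin (W * W.transpose)).IsPositive :=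
    Matrix.isPositive_toEuclideanLin_iff.mpr hpos
  have hs := hp.isSymmetric
  have hN : Module.finrank ℝ (EuclideanSpace ℝ (Fin N)) = N := by simp
  have h0 := hp.nonneg_eigenvalues hN
  refine ⟨⟨fun t => hs.eigenvectorBasis hN t, fun t => √(hs.eigenvalues hN t),
    (hs.eigenvectorBasis hN).orthonormal, fun t => Real.sqrt_nonneg _,
    fun a b hab => Real.sqrt_le_sqrt (hs.eigenvalues_antitone hN hab), fun t => ?_⟩⟩
  have h := congrArg WithLp.ofLp (hs.apply_eigenvectorBasis hN t)
  rw [Real.sq_sqrt (h0 t)]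
  rw [Matrix.ofLp_toLpLin, Matrix.toLin'_apply] at h
  exact h

/-! ### The FKV algorithm -/

/-- The number `p` of sampled rows (and of sampled columns): polynomial in `k`, `1/ε` and
`log (1/δ)`. -/
def fkvSamples (k : ℕ) (ε δ : ℝ) : ℕ :=
  ⌈10 ^ 7 * max ((k : ℝ) ^ 4 / ε ^ 3) ((k : ℝ) ^ 2 / ε ^ 4) * (1 + Real.log (1 / δ))⌉₊ + 1

instance fkvSamples.instNeZero (k : ℕ) (ε δ : ℝ) : NeZero (fkvSamples k ε δ) :=
  ⟨Nat.succ_ne_zero _⟩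

section Steps

variable {m n p : ℕ} [NeZero m] [NeZero n] [NeZero p]

/-- Distribution of a sampled row index: a sample from the vector of the row norms of `A`. -/
def rowDist (A : Matrix (Fin m) (Fin n) ℝ) : PMF (Fin m) :=
  l2Sample (fun i => √(∑ j, A i j ^ 2))

/-- The sampled and rescaled rows: row `t` of `S` is `A_(i_t) / √(p P(i_t))`, where
`P` is the distribution of the row indices. -/
def rowSketch (A : Matrix (Fin m) (Fin n) ℝ) (rows : Fin p → Fin m) :
    Matrix (Fin p) (Fin n) ℝ :=
  fun t j => A (rows t) j / √(p * (rowDist A (rows t)).toReal)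

/-- Distribution of a sampled column index, given the sampled rows: choose one of the `p` sampled
rows uniformly at random, then sample from that row. -/
def colDist (A : Matrix (Fin m) (Fin n) ℝ) (rows : Fin p → Fin m) : PMF (Fin n) :=
  (PMF.uniformOfFintype (Fin p)).bind fun t => l2Sample (A (rows t))

/-- The sampled and rescaled columns of `S`: column `s` of `W` is `S^(j_s) / √(p P'(j_s))`, where
`P'` is the distribution of the column indices. -/
def colSketch (A : Matrix (Fin m) (Fin n) ℝ) (rows : Fin p → Fin m) (cols : Fin p → Fin n) :
    Matrix (Fin p) (Fin p) ℝ :=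
  fun t s => rowSketch A rows t (cols s) / √(p * (colDist A rows (cols s)).toReal)

end Steps

/-- The description that the algorithm returns: the indices of the sampled rows, and `l` singular
vectors `u` with their singular values `σ`. -/
structure FKVDescription (m p : ℕ) where
  rows : Fin p → Fin m
  l : ℕ
  u : Fin l → Fin p → ℝ
  σ : Fin l → ℝ

/-- The matrix `V̂` encoded by a description: column `i` is `Sᵀ u_i / σ_i`. -/
def FKVDescription.Vhat {m n p : ℕ} [NeZero m] (A : Matrix (Fin m) (Fin n) ℝ)
    (d : FKVDescription m p) : Matrix (Fin n) (Fin d.l) ℝ :=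
  fun j i => (∑ t, rowSketch A d.rows t j * d.u i t) / d.σ i

/-- The number of singular vectors kept: those among the top `k` that pass the filter
`σ_t ^ 2 ≥ ε / (8 k) * ‖W‖_F ^ 2`. -/
def fkvKept {p : ℕ} (W : Matrix (Fin p) (Fin p) ℝ) (σ : Fin p → ℝ) (k : ℕ) (ε : ℝ) : ℕ :=
  (Finset.univ.filter fun t : Fin p =>
    (t : ℕ) < k ∧ ε / (8 * k) * frobSq W ≤ σ t ^ 2).card

theorem fkvKept_le {p : ℕ} (W : Matrix (Fin p) (Fin p) ℝ) (σ : Fin p → ℝ) (k : ℕ) (ε : ℝ) :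
    fkvKept W σ k ε ≤ p :=
  (Finset.card_le_univ _).trans_eq (Fintype.card_fin p)

/-- The deterministic part of the algorithm.  As the singular values are in decreasing order, the
singular vectors that pass the filter are the first `fkvKept` ones. -/
def fkvDescribe {m n p : ℕ} [NeZero m] [NeZero n] [NeZero p]
    (svd : ∀ (N : ℕ) (W : Matrix (Fin N) (Fin N) ℝ), LeftSVD W)
    (A : Matrix (Fin m) (Fin n) ℝ) (k : ℕ) (ε : ℝ)
    (rows : Fin p → Fin m) (cols : Fin p → Fin n) : FKVDescription m p :=
  let W := colSketch A rows cols
  { rows := rows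
    l := fkvKept W (svd p W).σ k ε
    u := fun i => ((svd p W).u (Fin.castLE (fkvKept_le W (svd p W).σ k ε) i)).ofLp
    σ := fun i => (svd p W).σ (Fin.castLE (fkvKept_le W (svd p W).σ k ε) i) }

/-- The randomized algorithm `FKV(A, k, ε, δ)`, as the law of its output: sample `p` rows of `A`
independently, sample `p` columns independently given the rows, compute left singular vectors of
the resulting `p × p` matrix with the routine `svd`, filter them, and return the description. -/
def FKV (svd : ∀ (N : ℕ) (W : Matrix (Fin N) (Fin N) ℝ), LeftSVD W)
    {m n : ℕ} [NeZero m] [NeZero n] (A : Matrix (Fin m) (Fin n) ℝ) (k : ℕ) (ε δ : ℝ) :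
    PMF (FKVDescription m (fkvSamples k ε δ)) :=
  (iidSample (fkvSamples k ε δ) (rowDist A)).bind fun rows =>
    (iidSample (fkvSamples k ε δ) (colDist A rows)).map fun cols =>
      fkvDescribe svd A k ε rows cols

end

/-!
Write `F = ‖A‖_F ^ 2`. As `F ≤ k σ_max ^ 2`, the hypothesis `ε < 1 / (k κ ^ 2)` says that every
squared nonzero singular value of `A` exceeds `ε F`, so `‖A x‖ ^ 2 ≥ ε F ‖x‖ ^ 2` on the row space
of `A` (`mul_frobSq_le_of_lt_condNumber`). It is enough that the two sampling steps preserve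
quadratic forms up to a quarter of this gap:
`|‖S v‖ ^ 2 - ‖A v‖ ^ 2| ≤ ε / 4 * F * ‖v‖ ^ 2` and
`|‖Wᵀ y‖ ^ 2 - ‖Sᵀ y‖ ^ 2| ≤ ε / 4 * F * ‖y‖ ^ 2` for all `v` and `y`.

Given these bounds, the conclusion is linear algebra (`fkvDescribe_spec`). The matrix `S` is
injective on the `k`-dimensional row space, and `‖Sᵀ y‖ ^ 2 ≥ 3 / 4 * ε F ‖y‖ ^ 2` on its image;
some nonzero vector of that image is orthogonal to the first `t < k` left singular vectors of `W`,
whence `σ_t ^ 2 ≥ ε F / 2` and all `k` leading singular vectors pass the filter. On their span `Sᵀ`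
is injective, since `Wᵀ` is larger there than the error. Hence the columns `Sᵀ u_t / σ_t` are `k`
independent vectors of the row space.

The bounds fail with probability at most `δ / 2` each (`sum_prod_le_of_quadForm_deviation`). The
matrix `SᵀS` is a sum of `p` independent rank-one matrices of Frobenius norm `F / p` with
expectation `AᵀA`, and likewise for `W Wᵀ` and `S Sᵀ`, because a column is in effect drawn with
probability proportional to its squared length in `S`. The number of samples depends on `δ` only
through `log (1 / δ)`, so a second moment bound would not do; a Hoeffding inequality in inner product
spaces is used (`sum_prod_le_exp_of_le_norm_sum`). It comes from the observation that adding an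
independent centred vector of norm at most `b` multiplies the expectation of `cosh ‖·‖` by at most
`cosh b` (`exists_cosh_norm_add_le`).
-/

/-! ### A Hoeffding inequality in inner product spaces -/

/-- Convexity of `s ↦ cosh √s`, which holds because its power series has nonnegative
coefficients. -/
lemma cosh_le_of_sq_le {x y w α β : ℝ} (hα : 0 ≤ α) (hβ : 0 ≤ β) (hαβ : α + β = 1)
    (h : w ^ 2 ≤ α * x ^ 2 + β * y ^ 2) :
    Real.cosh w ≤ α * Real.cosh x + β * Real.cosh y := by
  refine hasSum_le (fun n => ?_) (Real.hasSum_cosh w)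
    (((Real.hasSum_cosh x).mul_left α).add ((Real.hasSum_cosh y).mul_left β))
  have hc := (convexOn_pow n).2 (Set.mem_Ici.mpr (sq_nonneg x)) (Set.mem_Ici.mpr (sq_nonneg y))
    hα hβ hαβ
  simp only [smul_eq_mul, ← pow_mul] at hc
  have hw := (pow_le_pow_left₀ (sq_nonneg w) h n)
  rw [← pow_mul] at hw
  rw [← mul_div_assoc, ← mul_div_assoc, ← add_div]
  gcongr
  exact hw.trans hc

section Hoeffding

variable {E : Type*} [NormedAddCommGroup E] [InnerProductSpace ℝ E]

/-- Up to a term that is linear in `y`, adding a vector of norm at most `b` multiplies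
`cosh ‖x‖` by at most `cosh b`. -/
lemma exists_cosh_norm_add_le (x : E) {b : ℝ} (hb : 0 < b) :
    ∃ K : ℝ, ∀ y : E, ‖y‖ ≤ b →
      Real.cosh ‖x + y‖ ≤ Real.cosh ‖x‖ * Real.cosh b + K * inner ℝ x y := by
  rcases eq_or_ne x 0 with rfl | hx
  · refine ⟨0, fun y hy => ?_⟩
    have h : |‖y‖| ≤ |b| := by rwa [abs_norm, abs_of_pos hb]
    simpa using Real.cosh_le_cosh.2 h
  have hr : 0 < ‖x‖ := norm_pos_iff.2 hx
  refine ⟨Real.sinh ‖x‖ * Real.sinh b / (‖x‖ * b), fun y hy => ?_⟩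
  have hxy := abs_le.1 ((abs_real_inner_le_norm x y).trans
    (mul_le_mul_of_nonneg_left hy hr.le))
  -- The cosine of the angle between `x` and `y`, measured as if `y` had norm `b`.
  set u : ℝ := inner ℝ x y / (‖x‖ * b) with hu
  have hrb : 0 < ‖x‖ * b := mul_pos hr hb
  have hu1 : -1 ≤ u := by rw [hu, le_div_iff₀ hrb]; linarith
  have hu2 : u ≤ 1 := by rw [hu, div_le_iff₀ hrb]; linarith
  have hin : inner ℝ x y = u * (‖x‖ * b) := by rw [hu]; field_simp
  have hsq : ‖x + y‖ ^ 2 ≤ (1 + u) / 2 * (‖x‖ + b) ^ 2 + (1 - u) / 2 * (‖x‖ - b) ^ 2 := by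
    rw [norm_add_sq_real, hin]
    have : ‖y‖ ^ 2 ≤ b ^ 2 := pow_le_pow_left₀ (norm_nonneg y) hy 2
    linarith
  have h := cosh_le_of_sq_le (by linarith) (by linarith) (by ring) hsq
  rw [Real.cosh_add, Real.cosh_sub] at h
  calc Real.cosh ‖x + y‖ ≤ _ := h
    _ = Real.cosh ‖x‖ * Real.cosh b + u * (Real.sinh ‖x‖ * Real.sinh b) := by ring
    _ = _ := by rw [hu]; ring

variable {α : Type*} [Fintype α]

/-- Peeling off the first factor of a sum over a finite power. -/
lemma sum_pi_fin_succ (p : ℕ) (f : (Fin (p + 1) → α) → ℝ) :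
    ∑ x, f x = ∑ a, ∑ y : Fin p → α, f (Fin.cons a y) := by
  rw [← Fintype.sum_prod_type', ← (Fin.consEquiv fun _ : Fin (p + 1) => α).sum_comp]
  rfl

/-- The expectation of `cosh ‖·‖` along a random walk with independent centred steps of norm at
most `b`. -/
lemma sum_prod_mul_cosh_norm_le {w : α → ℝ} (hw : ∀ a, 0 ≤ w a) (hw1 : ∑ a, w a = 1)
    {Y : α → E} (hY : ∑ a, w a • Y a = 0) {b : ℝ} (hb : 0 < b) (hYb : ∀ a, ‖Y a‖ ≤ b)
    (p : ℕ) (v : E) :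
    ∑ x : Fin p → α, (∏ t, w (x t)) * Real.cosh ‖v + ∑ t, Y (x t)‖ ≤
      Real.cosh ‖v‖ * Real.cosh b ^ p := by
  induction p generalizing v with
  | zero => simp
  | succ p ih =>
    rw [sum_pi_fin_succ]
    simp only [Fin.prod_univ_succ, Fin.sum_univ_succ, Fin.cons_zero, Fin.cons_succ, mul_assoc,
      ← Finset.mul_sum, ← add_assoc]
    obtain ⟨K, hK⟩ := exists_cosh_norm_add_le v hb
    calc ∑ a, w a * ∑ y : Fin p → α, (∏ t, w (y t)) * Real.cosh ‖v + Y a + ∑ t, Y (y t)‖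
        ≤ ∑ a, w a * (Real.cosh ‖v + Y a‖ * Real.cosh b ^ p) :=
          Finset.sum_le_sum fun a _ => mul_le_mul_of_nonneg_left (ih _) (hw a)
      _ ≤ ∑ a, w a * ((Real.cosh ‖v‖ * Real.cosh b + K * inner ℝ v (Y a)) *
            Real.cosh b ^ p) := by
          gcongr with a
          · exact hw a
          · exact hK _ (hYb a)
      _ = (∑ a, w a) * (Real.cosh ‖v‖ * Real.cosh b ^ (p + 1)) +
            K * Real.cosh b ^ p * inner ℝ v (∑ a, w a • Y a) := by
          simp only [inner_sum, inner_smul_right, Finset.mul_sum, Finset.sum_mul,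
            ← Finset.sum_add_distrib]
          exact Finset.sum_congr rfl fun a _ => by ring
      _ = _ := by rw [hY, hw1]; simp

/-- Hoeffding's inequality for independent, identically distributed centred vectors in an inner
product space: the bound does not depend on the dimension. -/
theorem sum_prod_le_exp_of_le_norm_sum {w : α → ℝ} (hw : ∀ a, 0 ≤ w a) (hw1 : ∑ a, w a = 1)
    {Y : α → E} (hY : ∑ a, w a • Y a = 0) {b : ℝ} (hb : 0 < b) (hYb : ∀ a, ‖Y a‖ ≤ b)
    {p : ℕ} (hp : 0 < p) {r : ℝ} (hr : 0 < r) (s : Finset (Fin p → α))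
    (hs : ∀ x ∈ s, r ≤ ‖∑ t, Y (x t)‖) :
    ∑ x ∈ s, ∏ t, w (x t) ≤ 2 * Real.exp (-(r ^ 2 / (2 * p * b ^ 2))) := by
  have hp' : (0 : ℝ) < p := Nat.cast_pos.2 hp
  -- The value of `c` that minimises `p * (c * b) ^ 2 / 2 - c * r`.
  set c : ℝ := r / (p * b ^ 2) with hc
  have hc0 : 0 < c := by positivity
  have hmain := sum_prod_mul_cosh_norm_le hw hw1 (Y := fun a => c • Y a) (b := c * b)
    (by simp_rw [smul_comm _ c]; rw [← Finset.smul_sum, hY, smul_zero]) (by positivity)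
    (fun a => by
      rw [norm_smul, Real.norm_of_nonneg hc0.le]
      exact mul_le_mul_of_nonneg_left (hYb a) hc0.le) p 0
  simp only [zero_add, norm_zero, Real.cosh_zero, one_mul, ← Finset.smul_sum, norm_smul,
    Real.norm_of_nonneg hc0.le] at hmain
  have hprod : ∀ x : Fin p → α, 0 ≤ ∏ t, w (x t) := fun x => Finset.prod_nonneg fun t _ => hw _
  have h1 : (∑ x ∈ s, ∏ t, w (x t)) * Real.cosh (c * r) ≤ Real.cosh (c * b) ^ p := by
    refine le_trans ?_ hmain
    rw [Finset.sum_mul]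
    refine (Finset.sum_le_sum fun x hx => ?_).trans (Finset.sum_le_sum_of_subset_of_nonneg
      (Finset.subset_univ s) fun x _ _ => mul_nonneg (hprod x) (Real.cosh_pos _).le)
    refine mul_le_mul_of_nonneg_left (Real.cosh_le_cosh.2 ?_) (hprod x)
    rw [abs_of_pos (by positivity), abs_of_nonneg (by positivity)]
    exact mul_le_mul_of_nonneg_left (hs x hx) hc0.le
  have h2 : Real.cosh (c * b) ^ p ≤ Real.exp (p * ((c * b) ^ 2 / 2)) := by
    rw [Real.exp_nat_mul]
    exact pow_le_pow_left₀ (Real.cosh_pos _).le (Real.cosh_le_exp_half_sq _) p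
  have h3 : Real.exp (c * r) / 2 ≤ Real.cosh (c * r) := by
    rw [Real.cosh_eq]
    have := Real.exp_pos (-(c * r))
    linarith
  have h4 : (∑ x ∈ s, ∏ t, w (x t)) * (Real.exp (c * r) / 2) ≤
      Real.exp (p * ((c * b) ^ 2 / 2)) :=
    (mul_le_mul_of_nonneg_left h3 (Finset.sum_nonneg fun x _ => hprod x)).trans (h1.trans h2)
  have h5 : -(r ^ 2 / (2 * p * b ^ 2)) = p * ((c * b) ^ 2 / 2) - c * r := by
    rw [hc]; field_simp; ring
  rw [h5, Real.exp_sub, ← mul_div_assoc, le_div_iff₀ (Real.exp_pos _)]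
  linarith

end Hoeffding

/-! ### Length-squared sampling preserves the quadratic form -/

/-- The rank-one matrix `v vᵀ`, as a vector whose Euclidean norm is its Frobenius norm. -/
def outerSq {κ : Type*} (v : κ → ℝ) : EuclideanSpace ℝ (κ × κ) :=
  WithLp.toLp 2 fun q => v q.1 * v q.2

lemma inner_outerSq {κ : Type*} [Fintype κ] (u v : κ → ℝ) :
    inner ℝ (outerSq u) (outerSq v) = (∑ j, u j * v j) ^ 2 := by
  simp only [PiLp.inner_apply, outerSq, Fintype.sum_prod_type, sq, Finset.sum_mul_sum]
  refine Finset.sum_congr rfl fun i _ => Finset.sum_congr rfl fun j _ => ?_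
  simp; ring

lemma norm_outerSq {κ : Type*} [Fintype κ] (v : κ → ℝ) : ‖outerSq v‖ = ∑ j, v j ^ 2 := by
  rw [norm_eq_sqrt_real_inner, inner_outerSq, Real.sqrt_sq]
  · simp [sq]
  · exact Finset.sum_nonneg fun j _ => mul_self_nonneg _

/-- If row `i` of `B` is drawn with probability `w i = ‖B i‖ ^ 2 / F` and divided by
`√(p * w i)`, then `p` independent draws reproduce the quadratic form `v ↦ ‖B v‖ ^ 2` up to
`θ * F * ‖v‖ ^ 2`, except with exponentially small probability.  The rescaled rank-one matrices
all have Frobenius norm at most `F / p`, so this is Hoeffding's inequality for them. -/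
theorem sum_prod_le_of_quadForm_deviation {ι κ : Type*} [Fintype ι] [Fintype κ]
    {B : ι → κ → ℝ} {w : ι → ℝ} {F : ℝ} (hF : 0 < F) (hw1 : ∑ i, w i = 1)
    (hwB : ∀ i, w i * F = ∑ j, B i j ^ 2) {p : ℕ} (hp : 0 < p) {θ : ℝ} (hθ : 0 < θ)
    (s : Finset (Fin p → ι))
    (hs : ∀ x ∈ s, ∃ v : κ → ℝ, θ * F * ∑ j, v j ^ 2 <
      |∑ t, (∑ j, B (x t) j / √(p * w (x t)) * v j) ^ 2 - ∑ i, (∑ j, B i j * v j) ^ 2|) :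
    ∑ x ∈ s, ∏ t, w (x t) ≤ 2 * Real.exp (-(p * θ ^ 2 / 8)) := by
  have hp' : (0 : ℝ) < p := Nat.cast_pos.2 hp
  have hw : ∀ i, 0 ≤ w i := fun i => by
    have : 0 ≤ w i * F := by rw [hwB]; positivity
    exact nonneg_of_mul_nonneg_left this hF
  set X : ι → EuclideanSpace ℝ (κ × κ) := fun i => (1 / (p * w i)) • outerSq (B i) with hX
  have hXb : ∀ i, ‖X i‖ ≤ F / p := fun i => by
    rw [hX, norm_smul, norm_outerSq, ← hwB, Real.norm_of_nonneg (by have := hw i; positivity)]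
    -- If `w i = 0`, the factor `1 / (p * w i)` is zero, and so is `X i`.
    rcases eq_or_ne (w i) 0 with h | h
    · simp [h]; positivity
    · apply le_of_eq; field_simp
  set μ := ∑ i, w i • X i with hμ
  have hμb : ‖μ‖ ≤ F / p := by
    refine (norm_sum_le _ _).trans ?_
    calc ∑ i, ‖w i • X i‖ ≤ ∑ i, w i * (F / p) := Finset.sum_le_sum fun i _ => by
          rw [norm_smul, Real.norm_of_nonneg (hw i)]
          exact mul_le_mul_of_nonneg_left (hXb i) (hw i)
      _ = F / p := by rw [← Finset.sum_mul, hw1, one_mul]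
  have hY0 : ∑ i, w i • (X i - μ) = 0 := by
    simp only [smul_sub, Finset.sum_sub_distrib, ← Finset.sum_smul, hw1, one_smul, ← hμ, sub_self]
  have hYb : ∀ i, ‖X i - μ‖ ≤ 2 * F / p := fun i => by
    refine (norm_sub_le _ _).trans ((add_le_add (hXb i) hμb).trans_eq (by ring))
  have key := sum_prod_le_exp_of_le_norm_sum hw hw1 hY0 (b := 2 * F / p) (by positivity) hYb hp
    (r := θ * F) (by positivity) s (fun x hx => ?_)
  · refine key.trans_eq ?_
    congr 3
    field_simp
    ring
  obtain ⟨v, hv⟩ := hs x hx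
  have hμv : inner ℝ μ (outerSq v) = (∑ i, (∑ j, B i j * v j) ^ 2) / p := by
    rw [hμ, sum_inner, Finset.sum_div]
    refine Finset.sum_congr rfl fun i _ => ?_
    rw [hX, inner_smul_left, inner_smul_left, inner_outerSq]
    rcases eq_or_ne (w i) 0 with h | h
    · have h0 : ∀ j, B i j = 0 := by
        have := hwB i
        rw [h, zero_mul, eq_comm, Finset.sum_eq_zero_iff_of_nonneg fun j _ => sq_nonneg _] at this
        exact fun j => pow_eq_zero_iff two_ne_zero |>.1 (this j (Finset.mem_univ j))
      simp [h0]
    · simp; field_simp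
  have hXv : ∀ i, inner ℝ (X i) (outerSq v) = (∑ j, B i j / √(p * w i) * v j) ^ 2 := fun i => by
    rw [hX, inner_smul_left, inner_outerSq]
    simp_rw [div_mul_eq_mul_div]
    rw [← Finset.sum_div, div_pow, Real.sq_sqrt (mul_nonneg hp'.le (hw i))]
    simp; ring
  have hin : inner ℝ (∑ t, (X (x t) - μ)) (outerSq v) =
      ∑ t, (∑ j, B (x t) j / √(p * w (x t)) * v j) ^ 2 - ∑ i, (∑ j, B i j * v j) ^ 2 := by
    rw [sum_inner]
    simp only [inner_sub_left, hXv, hμv, Finset.sum_sub_distrib, Finset.sum_const,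
      Finset.card_univ, Fintype.card_fin, nsmul_eq_mul]
    field_simp
  rw [← hin, ← norm_outerSq] at hv
  by_contra! hlt
  exact absurd (hv.trans_le (abs_real_inner_le_norm _ _))
    (not_lt.2 (mul_le_mul_of_nonneg_right hlt.le (norm_nonneg _)))

/-! ### Singular values and the quadratic form `‖T x‖ ^ 2` -/

section SingularValues

variable {E G : Type*} [NormedAddCommGroup E] [InnerProductSpace ℝ E] [FiniteDimensional ℝ E]
  [NormedAddCommGroup G] [InnerProductSpace ℝ G] [FiniteDimensional ℝ G]

/-- The quadratic form of `T† T`, expanded in its eigenbasis. -/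
lemma norm_sq_apply_eq_sum (T : E →ₗ[ℝ] G) (x : E) :
    ‖T x‖ ^ 2 = ∑ i : Fin (Module.finrank ℝ E), T.singularValues i ^ 2 *
      inner ℝ (T.isSymmetric_adjoint_comp_self.eigenvectorBasis rfl i) x ^ 2 := by
  have h : ‖T x‖ ^ 2 = inner ℝ ((T.adjoint ∘ₗ T) x) x := by
    rw [LinearMap.comp_apply, LinearMap.adjoint_inner_left, real_inner_self_eq_norm_sq]
  rw [h, ← OrthonormalBasis.sum_inner_mul_inner
    (T.isSymmetric_adjoint_comp_self.eigenvectorBasis rfl)]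
  refine Finset.sum_congr rfl fun i _ => ?_
  rw [T.isSymmetric_adjoint_comp_self, LinearMap.IsSymmetric.apply_eigenvectorBasis,
    inner_smul_right, T.sq_singularValues_fin rfl, real_inner_comm x]
  simp
  ring

/-- The squared Frobenius norm of `T` is at most its rank times its largest squared singular
value. -/
lemma sum_norm_sq_apply_le (T : E →ₗ[ℝ] G) {ι : Type*} [Fintype ι]
    (e : OrthonormalBasis ι ℝ E) :
    ∑ j, ‖T (e j)‖ ^ 2 ≤ Module.finrank ℝ T.range * T.singularValues 0 ^ 2 := by
  set b := T.isSymmetric_adjoint_comp_self.eigenvectorBasis rfl with hb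
  have h1 : ∑ j, ‖T (e j)‖ ^ 2 =
      ∑ i : Fin (Module.finrank ℝ E), T.singularValues i ^ 2 := by
    simp_rw [norm_sq_apply_eq_sum T]
    rw [Finset.sum_comm]
    refine Finset.sum_congr rfl fun i _ => ?_
    rw [← Finset.mul_sum]
    have := e.sum_sq_norm_inner_left (b i)
    simp only [Real.norm_eq_abs, sq_abs, b.norm_eq_one, one_pow] at this
    rw [this, mul_one]
  have h2 : ∑ i : Fin (Module.finrank ℝ E), T.singularValues i ^ 2 ≤
      ∑ i ∈ Finset.range (Module.finrank ℝ T.range), T.singularValues i ^ 2 := by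
    rw [Fin.sum_univ_eq_sum_range (fun i => T.singularValues i ^ 2)]
    refine (Finset.sum_subset (Finset.range_mono T.finrank_range_le) fun i _ hi => ?_).ge
    rw [T.singularValues_eq_zero_iff_le_finrank_range.2 (by simpa using hi)]
    simp
  rw [h1]
  refine h2.trans ((Finset.sum_le_card_nsmul _ _ (T.singularValues 0 ^ 2) fun i _ => ?_).trans_eq
    (by simp))
  exact pow_le_pow_left₀ (T.singularValues_nonneg i) (T.singularValues_antitone (Nat.zero_le i)) 2

/-- On the orthogonal complement of its kernel, `T` expands lengths at least by the smallest
nonzero singular value. -/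
lemma sq_singularValues_mul_norm_sq_le (T : E →ₗ[ℝ] G) {x : E} (hx : x ∈ (LinearMap.ker T)ᗮ) :
    T.singularValues (Module.finrank ℝ T.range - 1) ^ 2 * ‖x‖ ^ 2 ≤ ‖T x‖ ^ 2 := by
  set b := T.isSymmetric_adjoint_comp_self.eigenvectorBasis rfl with hb
  have hn : ‖x‖ ^ 2 = ∑ i, inner ℝ (b i) x ^ 2 := by
    rw [← b.sum_sq_norm_inner_right x]
    simp
  rw [norm_sq_apply_eq_sum, hn, Finset.mul_sum]
  refine Finset.sum_le_sum fun i _ => ?_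
  rcases lt_or_ge (i : ℕ) (Module.finrank ℝ T.range) with hi | hi
  · refine mul_le_mul_of_nonneg_right (pow_le_pow_left₀ (T.singularValues_nonneg _)
      (T.singularValues_antitone (by omega)) 2) (sq_nonneg _)
  · have hker : b i ∈ LinearMap.ker T := by
      rw [LinearMap.mem_ker, ← norm_eq_zero, ← pow_eq_zero_iff two_ne_zero,
        norm_sq_apply_eq_sum, ← hb]
      refine Finset.sum_eq_zero fun j _ => ?_
      rcases eq_or_ne j i with rfl | hij
      · rw [T.singularValues_eq_zero_iff_le_finrank_range.2 hi]; simp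
      · rw [b.orthonormal.2 hij]; simp
    rw [Submodule.inner_right_of_mem_orthogonal hker hx]
    simp

end SingularValues

/-! ### The spectral gap supplied by the condition number -/

lemma dotProduct_self_eq_sum_sq {ι : Type*} [Fintype ι] (v : ι → ℝ) :
    v ⬝ᵥ v = ∑ i, v i ^ 2 := by
  simp [dotProduct, sq]

lemma frobSq_pos {m n : ℕ} {A : Matrix (Fin m) (Fin n) ℝ} (hA : A ≠ 0) : 0 < frobSq A := by
  obtain ⟨i, j, hij⟩ : ∃ i j, A i j ≠ 0 := by
    by_contra! h
    exact hA (Matrix.ext h)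
  refine Finset.sum_pos' (fun i _ => Finset.sum_nonneg fun j _ => sq_nonneg _)
    ⟨i, Finset.mem_univ i, ?_⟩
  exact Finset.sum_pos' (fun j _ => sq_nonneg _) ⟨j, Finset.mem_univ j, by positivity⟩

/-- If `ε < 1 / (k κ ^ 2)`, then every squared nonzero singular value of `A` is at least
`ε ‖A‖_F ^ 2`; here this is expressed by the quadratic form on the row space. -/
lemma mul_frobSq_le_of_lt_condNumber {m n : ℕ} {A : Matrix (Fin m) (Fin n) ℝ} (hA : A ≠ 0)
    {ε : ℝ} (hε : 0 < ε) (hεκ : ε < 1 / (A.rank * condNumber A ^ 2)) {x : Fin n → ℝ}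
    (hx : x ∈ Submodule.span ℝ (Set.range A.row)) :
    ε * frobSq A * ∑ j, x j ^ 2 ≤ ∑ i, (∑ j, A i j * x j) ^ 2 := by
  set T := Matrix.toEuclideanLin A with hT
  have hTx : ∀ z : EuclideanSpace ℝ (Fin n), (T z).ofLp = A.mulVec z.ofLp := fun z => by
    rw [hT, Matrix.ofLp_toLpLin, Matrix.toLin'_apply]
  have hrank : Module.finrank ℝ T.range = A.rank := (A.rank_eq_finrank_range_toLin
    (EuclideanSpace.basisFun (Fin m) ℝ).toBasis (EuclideanSpace.basisFun (Fin n) ℝ).toBasis).symm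
  have hF : frobSq A ≤ A.rank * T.singularValues 0 ^ 2 := by
    rw [← hrank]
    refine le_trans (le_of_eq ?_) (sum_norm_sq_apply_le T (EuclideanSpace.basisFun (Fin n) ℝ))
    rw [frobSq, Finset.sum_comm]
    refine Finset.sum_congr rfl fun j _ => ?_
    rw [EuclideanSpace.real_norm_sq_eq, hTx]
    simp
  have hF0 := frobSq_pos hA
  -- A vanishing denominator `k κ ^ 2` would make the bound on `ε` equal to `0 < ε < 0`.
  have hσ : ε * frobSq A ≤ T.singularValues (A.rank - 1) ^ 2 := by
    have hpos : 0 < A.rank * condNumber A ^ 2 := by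
      have := hε.trans hεκ
      rwa [one_div, inv_pos] at this
    rw [lt_div_iff₀ hpos] at hεκ
    have hs : T.singularValues (A.rank - 1) ≠ 0 := by
      intro h0
      rw [condNumber, ← hT, h0] at hpos
      simp at hpos
    have hs2 : 0 < T.singularValues (A.rank - 1) ^ 2 := by positivity
    rw [condNumber, ← hT, div_pow, ← mul_div_assoc, ← mul_div_assoc, div_lt_one hs2] at hεκ
    exact (mul_le_mul_of_nonneg_left hF hε.le).trans hεκ.le
  have hker : WithLp.toLp 2 x ∈ (LinearMap.ker T)ᗮ := by
    rw [Submodule.mem_orthogonal]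
    intro z hz
    have hz0 : ∀ i, ∑ j, A i j * z j = 0 := fun i => by
      have h := hTx z
      rw [LinearMap.mem_ker.1 hz] at h
      exact (congrFun h i).symm
    induction hx using Submodule.span_induction with
    | mem x h =>
      obtain ⟨i, rfl⟩ := h
      simpa [PiLp.inner_apply] using hz0 i
    | zero => exact inner_zero_right z
    | add x y _ _ hx hy => rw [WithLp.toLp_add, inner_add_right, hx, hy, add_zero]
    | smul c x _ hx => rw [WithLp.toLp_smul, inner_smul_right, hx, mul_zero]
  have h := sq_singularValues_mul_norm_sq_le T hker
  rw [hrank, EuclideanSpace.real_norm_sq_eq, EuclideanSpace.real_norm_sq_eq, hTx] at h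
  exact (mul_le_mul_of_nonneg_right hσ (Finset.sum_nonneg fun j _ => sq_nonneg _)).trans h

/-! ### Exact recovery of the row space -/

namespace LeftSVD

variable {p : ℕ} {W : Matrix (Fin p) (Fin p) ℝ}

/-- The left singular vectors, as an orthonormal basis. -/
noncomputable def basis (d : LeftSVD W) : OrthonormalBasis (Fin p) ℝ (EuclideanSpace ℝ (Fin p)) :=
  OrthonormalBasis.mk d.orthonormal
    (d.orthonormal.linearIndependent.span_eq_top_of_card_eq_finrank' (by simp)).ge

@[simp]
lemma basis_apply (d : LeftSVD W) (t : Fin p) : d.basis t = d.u t := by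
  simp [basis]

lemma sum_sq_inner (d : LeftSVD W) (y : EuclideanSpace ℝ (Fin p)) :
    ∑ t, inner ℝ (d.u t) y ^ 2 = ∑ t, y t ^ 2 := by
  rw [← EuclideanSpace.real_norm_sq_eq, ← d.basis.sum_sq_norm_inner_right y]
  simp

/-- The quadratic form of `W Wᵀ` in the basis of left singular vectors. -/
lemma sum_sq_transpose_mulVec (d : LeftSVD W) (y : EuclideanSpace ℝ (Fin p)) :
    ∑ s, (∑ t, W t s * y t) ^ 2 = ∑ t, d.σ t ^ 2 * inner ℝ (d.u t) y ^ 2 := by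
  have hdot : ∀ a b : EuclideanSpace ℝ (Fin p), inner ℝ a b = a.ofLp ⬝ᵥ b.ofLp := fun a b => by
    simp [PiLp.inner_apply, dotProduct, mul_comm]
  set N := WithLp.toLp 2 ((W * W.transpose).mulVec y.ofLp) with hN
  have h1 : ∑ s, (∑ t, W t s * y t) ^ 2 = inner ℝ y N := by
    rw [hdot, hN, ← Matrix.mulVec_mulVec, Matrix.dotProduct_mulVec, ← Matrix.mulVec_transpose,
      dotProduct_self_eq_sum_sq]
    rfl
  rw [h1, ← d.basis.sum_inner_mul_inner]
  refine Finset.sum_congr rfl fun t _ => ?_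
  have h2 : inner ℝ (d.u t) N = d.σ t ^ 2 * inner ℝ (d.u t) y := by
    rw [hdot, hdot, hN, Matrix.dotProduct_mulVec, ← Matrix.mulVec_transpose,
      Matrix.transpose_mul, Matrix.transpose_transpose, d.eigen, smul_dotProduct, smul_eq_mul]
  rw [d.basis_apply, h2, real_inner_comm]
  ring

end LeftSVD

section Recovery

variable {n p k : ℕ} {S : Matrix (Fin p) (Fin n) ℝ} {W : Matrix (Fin p) (Fin p) ℝ}
  {R : Submodule ℝ (Fin n → ℝ)} {c η : ℝ}

/-- A dimension count: fewer than `k` orthogonality conditions on `S x` have a common nonzero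
solution `x` in a `k`-dimensional space. -/
lemma exists_mem_forall_inner_eq_zero (hR : Module.finrank ℝ R = k) {q : ℕ} (hq : q < k)
    (u : Fin q → EuclideanSpace ℝ (Fin p)) :
    ∃ x ∈ R, x ≠ 0 ∧ ∀ t, inner ℝ (u t) (WithLp.toLp 2 (S.mulVec x)) = 0 := by
  let f : R →ₗ[ℝ] (Fin q → ℝ) := LinearMap.pi fun t =>
    (innerₛₗ ℝ (u t)) ∘ₗ (Matrix.toEuclideanLin S) ∘ₗ
      (WithLp.linearEquiv 2 ℝ (Fin n → ℝ)).symm.toLinearMap ∘ₗ R.subtype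
  have hf : LinearMap.ker f ≠ ⊥ := LinearMap.ker_ne_bot_of_finrank_lt (by simpa [hR] using hq)
  obtain ⟨x, hx, hx0⟩ := Submodule.exists_mem_ne_zero_of_ne_bot hf
  refine ⟨x, x.2, fun h => hx0 (Subtype.ext h), fun t => ?_⟩
  exact congrFun (LinearMap.mem_ker.1 hx) t

lemma rank_le_of_quadForm_pos (hR : Module.finrank ℝ R = k)
    (hS : ∀ x ∈ R, x ≠ 0 → 0 < ∑ t, (∑ j, S t j * x j) ^ 2) : k ≤ p := by
  by_contra! hpk
  obtain ⟨x, hx, hx0, h⟩ := exists_mem_forall_inner_eq_zero (S := S) hR hpk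
    (EuclideanSpace.basisFun (Fin p) ℝ)
  refine (hS x hx hx0).ne' (Finset.sum_eq_zero fun t _ => ?_)
  have ht := h t
  rw [EuclideanSpace.basisFun_inner] at ht
  exact pow_eq_zero_iff two_ne_zero |>.2 ht

/-- A lower bound for `S` at `x` passes to `Sᵀ` at `y = S x`, by the Cauchy-Schwarz inequality for
`‖y‖ ^ 2 = ⟪x, Sᵀ y⟫`. -/
lemma quadForm_transpose_ge (hc : 0 < c) {x : Fin n → ℝ}
    (hx : c * ∑ j, x j ^ 2 ≤ ∑ t, (∑ j, S t j * x j) ^ 2) {y : Fin p → ℝ}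
    (hy : ∀ t, y t = ∑ j, S t j * x j) :
    c * ∑ t, y t ^ 2 ≤ ∑ j, (∑ t, S t j * y t) ^ 2 := by
  simp_rw [← hy] at hx
  have hyy : ∑ t, y t ^ 2 = ∑ j, x j * ∑ t, S t j * y t := by
    simp_rw [Finset.mul_sum]
    rw [Finset.sum_comm]
    refine Finset.sum_congr rfl fun t _ => ?_
    rw [sq]
    nth_rewrite 1 [hy t]
    rw [Finset.sum_mul]
    exact Finset.sum_congr rfl fun j _ => by ring
  have hcs := Finset.sum_mul_sq_le_sq_mul_sq Finset.univ x (fun j => ∑ t, S t j * y t)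
  rw [← hyy] at hcs
  set a := ∑ t, y t ^ 2
  set z := ∑ j, (∑ t, S t j * y t) ^ 2
  have ha : 0 ≤ a := Finset.sum_nonneg fun _ _ => sq_nonneg _
  have hz : 0 ≤ z := Finset.sum_nonneg fun _ _ => sq_nonneg _
  rcases ha.eq_or_lt with h0 | h0
  · rw [← h0, mul_zero]; exact hz
  · refine le_of_mul_le_mul_right ?_ h0
    have := mul_le_mul_of_nonneg_left hcs hc.le
    have h2 := mul_le_mul_of_nonneg_right hx hz
    linarith

/-- A weak form of the perturbation bound for singular values: the top `k` squared singular values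
of `W` are at least `c - η`. The `k`-dimensional space `S R` contains a vector orthogonal to the
first `t₀ < k` left singular vectors. -/
lemma LeftSVD.sub_le_sq_of_lt (d : LeftSVD W) (hR : Module.finrank ℝ R = k) (hc : 0 < c)
    (hS : ∀ x ∈ R, c * ∑ j, x j ^ 2 ≤ ∑ t, (∑ j, S t j * x j) ^ 2)
    (hW : ∀ y : Fin p → ℝ, |∑ s, (∑ t, W t s * y t) ^ 2 - ∑ j, (∑ t, S t j * y t) ^ 2| ≤
      η * ∑ t, y t ^ 2) {t₀ : Fin p} (ht₀ : (t₀ : ℕ) < k) :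
    c - η ≤ d.σ t₀ ^ 2 := by
  obtain ⟨x, hx, hx0, h⟩ := exists_mem_forall_inner_eq_zero (S := S) hR ht₀
    (fun t => d.u (Fin.castLE t₀.2.le t))
  set y : EuclideanSpace ℝ (Fin p) := WithLp.toLp 2 (S.mulVec x) with hy
  have hSx := hS x hx
  have hST := quadForm_transpose_ge (S := S) hc hSx (y := y) fun t => rfl
  have hx2 : 0 < ∑ j, x j ^ 2 := by
    obtain ⟨j, hj⟩ := Function.ne_iff.1 hx0
    have hj' : x j ≠ 0 := hj
    exact Finset.sum_pos' (fun j _ => sq_nonneg _) ⟨j, Finset.mem_univ j, by positivity⟩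
  have hy2 : 0 < ∑ t, y t ^ 2 := (mul_pos hc hx2).trans_le hSx
  have hWy : ∑ s, (∑ t, W t s * y t) ^ 2 ≤ d.σ t₀ ^ 2 * ∑ t, y t ^ 2 := by
    rw [d.sum_sq_transpose_mulVec, ← d.sum_sq_inner, Finset.mul_sum]
    refine Finset.sum_le_sum fun t _ => ?_
    rcases lt_or_ge t t₀ with ht | ht
    · have h0 : inner ℝ (d.u t) y = 0 := h ⟨t, ht⟩
      simp [h0]
    · exact mul_le_mul_of_nonneg_right
        (pow_le_pow_left₀ (d.nonneg t) (d.antitone ht) 2) (sq_nonneg _)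
  have := (abs_le.1 (hW y)).1
  refine le_of_mul_le_mul_right ?_ hy2
  linarith

/-- The vectors `Sᵀ u_t / σ_t` for an initial segment of left singular vectors of `W` whose squared
singular values exceed `η` are linearly independent: on their span the quadratic forms of `Wᵀ` and
`Sᵀ` differ by less than the former. -/
lemma LeftSVD.linearIndependent_transpose (d : LeftSVD W)
    (hW : ∀ y : Fin p → ℝ, |∑ s, (∑ t, W t s * y t) ^ 2 - ∑ j, (∑ t, S t j * y t) ^ 2| ≤
      η * ∑ t, y t ^ 2) (hη : 0 ≤ η) {l : ℕ} (hl : l ≤ p)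
    (hσ : ∀ i : Fin l, η < d.σ (Fin.castLE hl i) ^ 2) :
    LinearIndependent ℝ fun (i : Fin l) (j : Fin n) =>
      (∑ t, S t j * d.u (Fin.castLE hl i) t) / d.σ (Fin.castLE hl i) := by
  rw [Fintype.linearIndependent_iff]
  intro a ha i
  have hσ0 : ∀ i : Fin l, d.σ (Fin.castLE hl i) ≠ 0 := fun i h0 => by
    have := hσ i
    rw [h0] at this
    linarith
  set y : EuclideanSpace ℝ (Fin p) :=
    ∑ i : Fin l, (a i / d.σ (Fin.castLE hl i)) • d.u (Fin.castLE hl i) with hy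
  have hSy : ∀ j, ∑ t, S t j * y t = 0 := fun j => by
    refine Eq.trans ?_ (congrFun ha j)
    simp only [hy, WithLp.ofLp_sum, Finset.sum_apply, WithLp.ofLp_smul, Pi.smul_apply, smul_eq_mul,
      Finset.mul_sum, Finset.sum_div]
    rw [Finset.sum_comm]
    exact Finset.sum_congr rfl fun i _ => Finset.sum_congr rfl fun t _ => by ring
  have hin : ∀ t, inner ℝ (d.u t) y = ∑ i : Fin l, if Fin.castLE hl i = t then
      a i / d.σ (Fin.castLE hl i) else 0 := fun t => by
    rw [hy, inner_sum]
    refine Finset.sum_congr rfl fun i _ => ?_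
    rw [inner_smul_right, orthonormal_iff_ite.1 d.orthonormal]
    simp [eq_comm]
  have hini : ∀ i : Fin l, inner ℝ (d.u (Fin.castLE hl i)) y = a i / d.σ (Fin.castLE hl i) :=
    fun i => by rw [hin]; simp
  have hWy := (le_abs_self _).trans (hW y)
  simp only [hSy, ne_eq, OfNat.ofNat_ne_zero, not_false_eq_true, zero_pow, Finset.sum_const_zero,
    sub_zero] at hWy
  rw [d.sum_sq_transpose_mulVec, ← d.sum_sq_inner, Finset.mul_sum] at hWy
  by_contra hai
  refine absurd hWy (not_le.2 (Finset.sum_lt_sum (fun t _ => ?_)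
    ⟨Fin.castLE hl i, Finset.mem_univ _, ?_⟩))
  · by_cases ht : (t : ℕ) < l
    · exact mul_le_mul_of_nonneg_right (hσ ⟨t, ht⟩).le (sq_nonneg _)
    · have h0 : inner ℝ (d.u t) y = 0 := by
        rw [hin]
        refine Finset.sum_eq_zero fun i _ => if_neg ?_
        rintro rfl
        exact ht i.2
      simp [h0]
  · refine mul_lt_mul_of_pos_right (hσ i) ?_
    rw [hini]
    have := hσ0 i
    positivity

end Recovery

/-! ### The sampling distributions -/

lemma sum_toReal_eq_one {α : Type*} [Fintype α] (P : PMF α) : ∑ a, (P a).toReal = 1 := by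
  rw [← ENNReal.toReal_sum fun a _ => P.apply_ne_top a, ← tsum_fintype (L := .unconditional α),
    P.tsum_coe, ENNReal.toReal_one]

lemma toReal_iidSample_apply {α : Type*} [Fintype α] {p : ℕ} (P : PMF α) (x : Fin p → α) :
    (iidSample p P x).toReal = ∏ t, (P (x t)).toReal := by
  rw [iidSample, PMF.ofFintype_apply, ENNReal.toReal_prod]

/-- An event has probability at least `1 - η` if sets of samples outside it have mass at most
`η`. -/
lemma ofReal_one_sub_le_toOuterMeasure_iidSample {α : Type*} [Fintype α] {p : ℕ} (P : PMF α)
    (s : Set (Fin p → α)) {η : ℝ}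
    (h : ∀ b : Finset (Fin p → α), (∀ x ∈ b, x ∉ s) → ∑ x ∈ b, ∏ t, (P (x t)).toReal ≤ η) :
    ENNReal.ofReal (1 - η) ≤ (iidSample p P).toOuterMeasure s := by
  classical
  have hb := h (Finset.univ.filter (· ∉ s)) fun x hx => (Finset.mem_filter.1 hx).2
  have h1 := sum_toReal_eq_one (iidSample p P)
  rw [← Finset.sum_filter_add_sum_filter_not Finset.univ (· ∈ s)] at h1
  simp_rw [toReal_iidSample_apply] at h1
  have h2 : (iidSample p P).toOuterMeasure s =
      ∑ x ∈ Finset.univ.filter (· ∈ s), iidSample p P x := by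
    rw [PMF.toOuterMeasure_apply_fintype, Finset.sum_filter]
    rfl
  rw [h2]
  refine ENNReal.ofReal_le_of_le_toReal ?_
  rw [ENNReal.toReal_sum fun x _ => PMF.apply_ne_top _ x]
  simp_rw [toReal_iidSample_apply]
  linarith

lemma toReal_l2Sample_mul {N : ℕ} [NeZero N] {v : Fin N → ℝ} (hv : ∑ j, v j ^ 2 ≠ 0) (i : Fin N) :
    (l2Sample v i).toReal * ∑ j, v j ^ 2 = v i ^ 2 := by
  rw [l2Sample, dif_neg hv, PMF.ofFintype_apply, ENNReal.toReal_ofReal (by positivity),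
    div_mul_cancel₀ _ hv]

lemma toReal_rowDist_mul {m n : ℕ} [NeZero m] {A : Matrix (Fin m) (Fin n) ℝ} (hA : A ≠ 0)
    (i : Fin m) : (rowDist A i).toReal * frobSq A = ∑ j, A i j ^ 2 := by
  have hsq : ∀ i, √(∑ j, A i j ^ 2) ^ 2 = ∑ j, A i j ^ 2 := fun i =>
    Real.sq_sqrt (Finset.sum_nonneg fun j _ => sq_nonneg _)
  have hF : ∑ i, √(∑ j, A i j ^ 2) ^ 2 = frobSq A := Finset.sum_congr rfl fun i _ => hsq i
  rw [rowDist, ← hF, toReal_l2Sample_mul (hF ▸ (frobSq_pos hA).ne'), hsq]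

section Sketch

variable {m n p : ℕ} [NeZero m] [NeZero n] [NeZero p] {A : Matrix (Fin m) (Fin n) ℝ}
  {rows : Fin p → Fin m}

/-- Given rows of positive probability, a column index has probability proportional to the squared
length of the corresponding column of the row sketch. -/
lemma toReal_colDist_mul (hA : A ≠ 0) (hrows : ∀ t, rowDist A (rows t) ≠ 0) (j : Fin n) :
    (colDist A rows j).toReal * frobSq A = ∑ t, rowSketch A rows t j ^ 2 := by
  have hp : (p : ℝ) ≠ 0 := Nat.cast_ne_zero.2 (NeZero.ne p)
  have hF := frobSq_pos hA
  have h1 : (colDist A rows j).toReal = ∑ t, (p : ℝ)⁻¹ * (l2Sample (A (rows t)) j).toReal := by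
    rw [colDist, PMF.bind_apply, tsum_fintype, ENNReal.toReal_sum fun t _ =>
      ENNReal.mul_ne_top (PMF.apply_ne_top _ _) (PMF.apply_ne_top _ _)]
    simp
  rw [h1, Finset.sum_mul]
  refine Finset.sum_congr rfl fun t _ => ?_
  have hw : 0 < (rowDist A (rows t)).toReal :=
    ENNReal.toReal_pos (hrows t) (PMF.apply_ne_top _ _)
  have hw2 := toReal_rowDist_mul hA (rows t)
  have hl : ∑ j, A (rows t) j ^ 2 ≠ 0 := hw2 ▸ (mul_pos hw hF).ne'
  have hl2 := toReal_l2Sample_mul hl j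
  rw [← hw2] at hl2
  rw [rowSketch, div_pow, Real.sq_sqrt (by positivity), ← hl2]
  field_simp

/-- Every column of `W` has squared length at most `‖A‖_F ^ 2 / p`. -/
lemma frobSq_colSketch_le (hA : A ≠ 0) (hrows : ∀ t, rowDist A (rows t) ≠ 0)
    (cols : Fin p → Fin n) : frobSq (colSketch A rows cols) ≤ frobSq A := by
  have hp : (0 : ℝ) < p := Nat.cast_pos.2 (NeZero.pos p)
  have hF := frobSq_pos hA
  have hcol : ∀ s, ∑ t, colSketch A rows cols t s ^ 2 ≤ frobSq A / p := fun s => by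
    have hw : 0 ≤ (colDist A rows (cols s)).toReal := ENNReal.toReal_nonneg
    simp_rw [colSketch, div_pow]
    rw [← Finset.sum_div, ← toReal_colDist_mul hA hrows, Real.sq_sqrt (by positivity)]
    rcases hw.eq_or_lt with h | h
    -- Division by `0` makes a column of probability zero vanish.
    · rw [← h]; simp; positivity
    · apply le_of_eq; field_simp
  rw [frobSq, Finset.sum_comm]
  refine (Finset.sum_le_sum fun s _ => hcol s).trans_eq ?_
  simp
  field_simp

/-- If both sketches preserve the relevant quadratic forms up to a quarter of the spectral gap
`ε ‖A‖_F ^ 2`, then exactly `k` singular vectors pass the filter, and they describe a basis of the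
row space. -/
lemma fkvDescribe_spec (svd : ∀ (N : ℕ) (W : Matrix (Fin N) (Fin N) ℝ), LeftSVD W)
    (hA : A ≠ 0) {ε : ℝ} (hε : 0 < ε) (hεκ : ε < 1 / (A.rank * condNumber A ^ 2))
    (hrows : ∀ t, rowDist A (rows t) ≠ 0) {cols : Fin p → Fin n}
    (hS : ∀ v : Fin n → ℝ, |∑ t, (∑ j, rowSketch A rows t j * v j) ^ 2 -
      ∑ i, (∑ j, A i j * v j) ^ 2| ≤ ε / 4 * frobSq A * ∑ j, v j ^ 2)
    (hW : ∀ y : Fin p → ℝ, |∑ s, (∑ t, colSketch A rows cols t s * y t) ^ 2 -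
      ∑ j, (∑ t, rowSketch A rows t j * y t) ^ 2| ≤ ε / 4 * frobSq A * ∑ t, y t ^ 2) :
    (fkvDescribe svd A A.rank ε rows cols).l ≤ A.rank ∧
      Submodule.span ℝ (Set.range ((fkvDescribe svd A A.rank ε rows cols).Vhat A).col) =
        Submodule.span ℝ (Set.range A.row) := by
  set W := colSketch A rows cols with hWdef
  set S := rowSketch A rows with hSdef
  set d := svd p W with hd
  set R := Submodule.span ℝ (Set.range A.row) with hRdef
  have hF := frobSq_pos hA
  have hR : Module.finrank ℝ R = A.rank := A.rank_eq_finrank_span_row.symm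
  have hSR : ∀ x ∈ R, 3 / 4 * (ε * frobSq A) * ∑ j, x j ^ 2 ≤ ∑ t, (∑ j, S t j * x j) ^ 2 :=
    fun x hx => by
      have h1 := mul_frobSq_le_of_lt_condNumber hA hε hεκ hx
      have h2 := (abs_le.1 (hS x)).1
      linarith
  have hkp : A.rank ≤ p := rank_le_of_quadForm_pos (S := S) hR fun x hx hx0 => by
    refine lt_of_lt_of_le ?_ (hSR x hx)
    obtain ⟨j, hj⟩ := Function.ne_iff.1 hx0
    have hj' : x j ≠ 0 := hj
    have := Finset.sum_pos' (fun j _ => sq_nonneg (x j)) ⟨j, Finset.mem_univ j, by positivity⟩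
    positivity
  have hσ : ∀ t : Fin p, (t : ℕ) < A.rank → ε / 2 * frobSq A ≤ d.σ t ^ 2 := fun t ht => by
    have := d.sub_le_sq_of_lt hR (by positivity) hSR hW ht
    linarith
  have hkept : fkvKept W d.σ A.rank ε = A.rank := by
    rw [fkvKept, Finset.filter_congr (q := fun t : Fin p => (t : ℕ) < A.rank),
      Fin.card_filter_val_lt, min_eq_right hkp]
    refine fun t _ => ⟨And.left, fun ht => ⟨ht, le_trans ?_ (hσ t ht)⟩⟩
    have hk1 : (1 : ℝ) ≤ A.rank := Nat.one_le_cast.2 (Nat.zero_lt_of_lt ht)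
    refine mul_le_mul (div_le_div_of_nonneg_left hε.le two_pos (by linarith))
      (frobSq_colSketch_le hA hrows cols) (Finset.sum_nonneg fun _ _ => Finset.sum_nonneg
        fun _ _ => sq_nonneg _) (by positivity)
  have hind : LinearIndependent ℝ ((fkvDescribe svd A A.rank ε rows cols).Vhat A).col :=
    d.linearIndependent_transpose hW (by positivity) (fkvKept_le W d.σ A.rank ε) fun i => by
      refine lt_of_lt_of_le ?_ (hσ _ (by simpa [hkept] using i.2))
      have : 0 < ε * frobSq A := mul_pos hε hF
      linarith
  refine ⟨hkept.le, Submodule.eq_of_le_of_finrank_eq ?_ ?_⟩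
  · rw [Submodule.span_le]
    rintro _ ⟨i, rfl⟩
    have hcol : ((fkvDescribe svd A A.rank ε rows cols).Vhat A).col i =
        ∑ t, ((fkvDescribe svd A A.rank ε rows cols).u i t /
          √(p * (rowDist A (rows t)).toReal) /
            (fkvDescribe svd A A.rank ε rows cols).σ i) • A.row (rows t) := by
      ext j
      simp only [Matrix.col_apply, FKVDescription.Vhat, Finset.sum_apply, Pi.smul_apply,
        Matrix.row_apply, smul_eq_mul, Finset.sum_div]
      refine Finset.sum_congr rfl fun t _ => ?_
      rw [rowSketch]
      simp only [fkvDescribe]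
      ring
    rw [hcol]
    exact Submodule.sum_mem _ fun t _ => Submodule.smul_mem _ _
      (Submodule.subset_span (Set.mem_range_self _))
  · rw [finrank_span_eq_card hind, Fintype.card_fin, hR]
    exact hkept

end Sketch

/-! ### The failure probability -/

/-- Hoeffding's bound at the accuracy `ε / 4` required of each of the two sketches. -/
lemma two_mul_exp_fkvSamples_le {k : ℕ} (hk : 1 ≤ k) {ε δ : ℝ} (hε : 0 < ε) (hε1 : ε < 1)
    (hδ : 0 < δ) (hδ1 : δ < 1) :
    2 * Real.exp (-(fkvSamples k ε δ * (ε / 4) ^ 2 / 8)) ≤ δ / 2 := by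
  have hL : 0 ≤ Real.log (1 / δ) := Real.log_nonneg (one_le_one_div hδ hδ1.le)
  have hk1 : (1 : ℝ) ≤ k := Nat.one_le_cast.2 hk
  have hmax : 1 / ε ^ 2 ≤ max ((k : ℝ) ^ 4 / ε ^ 3) ((k : ℝ) ^ 2 / ε ^ 4) := by
    refine le_trans ?_ (le_max_right _ _)
    exact div_le_div₀ (by positivity) (one_le_pow₀ hk1) (by positivity)
      (pow_le_pow_of_le_one hε.le hε1.le (by norm_num))
  have hp : 10 ^ 7 * (1 / ε ^ 2) * (1 + Real.log (1 / δ)) ≤ fkvSamples k ε δ := by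
    rw [fkvSamples, Nat.cast_add]
    refine le_trans ?_ ((Nat.le_ceil _).trans (le_add_of_nonneg_right (Nat.cast_nonneg _)))
    gcongr
  have hpε : 10 ^ 7 * (1 + Real.log (1 / δ)) ≤ fkvSamples k ε δ * ε ^ 2 := by
    refine le_trans (le_of_eq ?_) (mul_le_mul_of_nonneg_right hp (sq_nonneg ε))
    field_simp
  have h4 : Real.log 4 ≤ 3 := (Real.log_le_sub_one_of_pos (by norm_num)).trans (by norm_num)
  have hexp : Real.exp (-(fkvSamples k ε δ * (ε / 4) ^ 2 / 8)) ≤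
      Real.exp (-(Real.log 4 + Real.log (1 / δ))) := by
    rw [Real.exp_le_exp]
    have : (fkvSamples k ε δ * (ε / 4) ^ 2 / 8 : ℝ) = fkvSamples k ε δ * ε ^ 2 / 128 := by ring
    rw [this]
    linarith
  rw [← Real.log_mul (by norm_num) (by positivity), ← Real.log_inv,
    Real.exp_log (by positivity)] at hexp
  refine (mul_le_mul_of_nonneg_left hexp two_pos.le).trans_eq ?_
  field_simp
  norm_num

lemma one_le_condNumber_sq {m n : ℕ} {A : Matrix (Fin m) (Fin n) ℝ} (hA : 0 < condNumber A ^ 2) :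
    1 ≤ condNumber A ^ 2 := by
  set T := Matrix.toEuclideanLin A with hT
  have hne : T.singularValues (A.rank - 1) ≠ 0 := fun h => by
    rw [condNumber, ← hT, h] at hA
    simp at hA
  have hpos := (T.singularValues_nonneg _).lt_of_ne hne.symm
  refine one_le_pow₀ ?_
  rw [condNumber, ← hT, one_le_div hpos]
  exact T.singularValues_antitone (Nat.zero_le _)

theorem mainTheorem2
    (svd : ∀ (N : ℕ) (W : Matrix (Fin N) (Fin N) ℝ), LeftSVD W)
    {m n : ℕ} [NeZero m] [NeZero n] (A : Matrix (Fin m) (Fin n) ℝ) (hA : A ≠ 0)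
    (k : ℕ) (hk : k = A.rank) (ε δ : ℝ) (hε : 0 < ε) (hδ : 0 < δ) (hδ1 : δ < 1)
    (hεκ : ε < 1 / (k * condNumber A ^ 2)) :
    ENNReal.ofReal (1 - δ) ≤
      (FKV svd A k ε δ).toOuterMeasure
        {d | d.l ≤ k ∧
          Submodule.span ℝ (Set.range (d.Vhat A).col) = Submodule.span ℝ (Set.range A.row)} := by
  have hpos : 0 < k * condNumber A ^ 2 := by
    have := hε.trans hεκ
    rwa [one_div, inv_pos] at this
  have hk1 : 1 ≤ k := Nat.one_le_iff_ne_zero.2 fun h => by simp [h] at hpos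
  have hκ := one_le_condNumber_sq (pos_of_mul_pos_right hpos (Nat.cast_nonneg k))
  have hε1 : ε < 1 := hεκ.trans_le <| by
    rw [div_le_one hpos]
    exact one_le_mul_of_one_le_of_one_le (Nat.one_le_cast.2 hk1) hκ
  have hF := frobSq_pos hA
  have hexp := two_mul_exp_fkvSamples_le hk1 hε hε1 hδ hδ1
  set p := fkvSamples k ε δ with hp
  have hp0 : 0 < p := NeZero.pos (fkvSamples k ε δ)
  -- Row samples for which the row sketch approximates `A`.
  let good : Set (Fin p → Fin m) := {rows | ∀ v : Fin n → ℝ,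
    |∑ t, (∑ j, rowSketch A rows t j * v j) ^ 2 - ∑ i, (∑ j, A i j * v j) ^ 2| ≤
      ε / 4 * frobSq A * ∑ j, v j ^ 2}
  have hgood : ENNReal.ofReal (1 - δ / 2) ≤ (iidSample p (rowDist A)).toOuterMeasure good := by
    refine ofReal_one_sub_le_toOuterMeasure_iidSample _ _ fun b hb => le_trans ?_ hexp
    refine sum_prod_le_of_quadForm_deviation hF (sum_toReal_eq_one _) (toReal_rowDist_mul hA)
      hp0 (by positivity) b fun x hx => ?_
    simpa [good, rowSketch] using hb x hx
  have hcols : ∀ rows : Fin p → Fin m, rows ∈ good → (∀ t, rowDist A (rows t) ≠ 0) →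
      ENNReal.ofReal (1 - δ / 2) ≤ (iidSample p (colDist A rows)).toOuterMeasure
        (fkvDescribe svd A k ε rows ⁻¹' {d | d.l ≤ k ∧
          Submodule.span ℝ (Set.range (d.Vhat A).col) =
            Submodule.span ℝ (Set.range A.row)}) := by
    intro rows hg hrows
    refine ofReal_one_sub_le_toOuterMeasure_iidSample _ _ fun b hb => le_trans ?_ hexp
    refine sum_prod_le_of_quadForm_deviation (B := fun j t => rowSketch A rows t j) hF
      (sum_toReal_eq_one _) (toReal_colDist_mul hA hrows) hp0 (by positivity) b fun x hx => ?_
    by_contra! hW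
    subst hk
    exact hb x hx (fkvDescribe_spec svd hA hε hεκ hrows hg hW)
  rw [FKV, PMF.toOuterMeasure_bind_apply]
  calc ENNReal.ofReal (1 - δ)
      ≤ ENNReal.ofReal (1 - δ / 2) * ENNReal.ofReal (1 - δ / 2) := by
        rw [← ENNReal.ofReal_mul (by linarith)]
        exact ENNReal.ofReal_le_ofReal (by nlinarith)
    _ ≤ (iidSample p (rowDist A)).toOuterMeasure good * ENNReal.ofReal (1 - δ / 2) := by
        gcongr
    _ = ∑' rows, good.indicator (iidSample p (rowDist A)) rows *
          ENNReal.ofReal (1 - δ / 2) := by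
        rw [PMF.toOuterMeasure_apply, ENNReal.tsum_mul_right]
    _ ≤ _ := by
        refine ENNReal.tsum_le_tsum fun rows => ?_
        by_cases hg : rows ∈ good
        · rw [Set.indicator_of_mem hg, PMF.toOuterMeasure_map_apply]
          by_cases h0 : ∀ t, rowDist A (rows t) ≠ 0
          · exact mul_le_mul_right (hcols rows hg h0) _
          -- A sample containing a row of probability zero has probability zero itself.
          · push Not at h0
            obtain ⟨t, ht⟩ := h0
            have : iidSample p (rowDist A) rows = 0 := by
              rw [iidSample, PMF.ofFintype_apply]
              exact Finset.prod_eq_zero (Finset.mem_univ t) ht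
            simp [this]
        · rw [Set.indicator_of_notMem hg]; simp
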